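/- Let $\Lambda$ be the von Mangoldt function, $\Gamma$ the gamma function, $G=\sum_{n\ge 0}(-1)^n(2n+1)^{-2}$ the Catalan constant, $C=\pi^2+8G$, and $\Phi(z,s,b)=\sum_{n\ge 0}(n+b)^{-s}z^n$ the Hurwitz–Lerch zeta function. For $t\ge 0$ put $$\Psi(t)=4(e^{t/2}+e^{-t/2}-2)-\sum_{1\le n\le e^t}\frac{\Lambda(n)}{\sqrt n}(t-\log n)+\frac t2\Big[\frac{\Gamma'}{\Gamma}\Big(\frac14\Big)-\log\pi\Big]+\frac14\Big(C-e^{-t/2}\,\Phi(e^{-2t},2,1/4)\Big),$$ extend $\Psi$ to an even function on $\mathbb R$ by $\Psi(-t)=\Psi(t)$, and put $g(t)=-\Psi(t)$ and $G_g(t,u)=g(t-u)-g(t)-g(-u)+g(0)$ for $t,u\in\mathbb R$. **Theorem 1.5.** For every $0<a<\infty$, the formula $$(\mathsf G_g[a]\phi)(t)=\int_{-a}^{a}G_g(t,u)\,\phi(u)\,du\qquad(\phi\in L^2(-a,a),\ t\in(-a,a))$$ (the integral converges absolutely for every $t\in[-a,a]$) defines a bounded linear operator $\mathsf G_g[a]$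 on the complex Hilbert space $L^2(-a,a)$, and this operator is of trace class, that is, $\sum_i\langle|\mathsf G_g[a]|e_i,e_i\rangle<\infty$ for every orthonormal basis $(e_i)$ of $L^2(-a,a)$, where $|T|=(T^*T)^{1/2}$. This holds unconditionally; in particular, the Riemann hypothesis is not assumed. -/

import Mathlib

open MeasureTheory

noncomputable section

/-- The Catalan constant `G = ∑_{n ≥ 0} (-1)^n (2n+1)^{-2}`. -/
def catalanConstant : ℝ := ∑' n : ℕ, (-1 : ℝ) ^ n / (2 * (n : ℝ) + 1) ^ 2

/-- The Hurwitz–Lerch zeta function `Φ(z, s, b) = ∑_{n ≥ 0} (n + b)^{-s} z^n`, for real arguments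
(used only with `0 < z ≤ 1`, `s = 2`, `b = 1/4`, where the series converges absolutely). -/
def hurwitzLerchPhi (z s b : ℝ) : ℝ := ∑' n : ℕ, ((n : ℝ) + b) ^ (-s) * z ^ n

/-- The explicit formula for `Ψ(t)`, used for `t ≥ 0`. -/
def psiFormula (t : ℝ) : ℝ :=
  4 * (Real.exp (t / 2) + Real.exp (-t / 2) - 2)
    - ∑ n ∈ Finset.Icc 1 ⌊Real.exp t⌋₊,
        ArithmeticFunction.vonMangoldt n / √(n : ℝ) * (t - Real.log n)
    + t / 2 * (deriv Real.Gamma (1 / 4) / Real.Gamma (1 / 4) - Real.log Real.pi)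
    + 1 / 4 * ((Real.pi ^ 2 + 8 * catalanConstant)
        - Real.exp (-t / 2) * hurwitzLerchPhi (Real.exp (-2 * t)) 2 (1 / 4))

/-- `Ψ`, extended from `[0, ∞)` to an even function on the real line. -/
def zetaPsi (t : ℝ) : ℝ := psiFormula |t|

/-- The screw function `g = -Ψ` of the Riemann zeta-function. -/
def zetaScrew (t : ℝ) : ℝ := -zetaPsi t

/-- The kernel `G_g(t,u) = g(t-u) - g(t) - g(-u) + g(0)` attached to a function `g`. -/
def screwKernel (g : ℝ → ℝ) (t u : ℝ) : ℝ := g (t - u) - g t - g (-u) + g 0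

/-- The complex Hilbert space `L²(-a,a)` with respect to Lebesgue measure. -/
abbrev L2Interval (a : ℝ) : Type := Lp ℂ 2 (volume.restrict (Set.Ioo (-a) a))

/-- `T` is the integral operator on `L²(-a,a)` with kernel `K`: for every `φ` in `L²(-a,a)` the
integral `∫_{-a}^{a} K(t,u) φ(u) du` converges absolutely for every `t` in `[-a,a]`, and it is equal
to `(T φ)(t)` for almost every `t` in `(-a,a)`. -/
def IsIntegralOperator (a : ℝ) (K : ℝ → ℝ → ℝ) (T : L2Interval a →L[ℂ] L2Interval a) : Prop :=
  ∀ φ : L2Interval a,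
    (∀ t ∈ Set.Icc (-a) a, IntegrableOn (fun u => (K t u : ℂ) * φ u) (Set.Ioo (-a) a)) ∧
      ∀ᵐ t ∂(volume.restrict (Set.Ioo (-a) a)),
        T φ t = ∫ u in Set.Ioo (-a) a, (K t u : ℂ) * φ u

/-- A bounded operator `T` on a complex Hilbert space `H` is of trace class if
`Tr |T| = ∑_i ⟨|T| e_i, e_i⟩ < ∞` for every orthonormal basis `(e_i)` of `H`,
where `|T| = (T* T)^{1/2}`. (Every orthonormal basis is indexed by a subset of `H`: its own range.) -/
def IsTraceClass {H : Type*} [NormedAddCommGroup H] [InnerProductSpace ℂ H] [CompleteSpace H]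
    (T : H →L[ℂ] H) : Prop :=
  ∀ (s : Set H) (e : HilbertBasis s ℂ H),
    Summable fun i : s => (inner ℂ (CFC.abs T (e i)) (e i)).re

end

/-! The function $g$ is smooth enough to split its kernel. On $[-2a,2a]$ it is a primitive of some
$h\in L^2$, so $G_g(t,u)=\int_0^t (h(s-u)-h(s))\,ds$. The operator is therefore the product $VS$ of
the Volterra operator $V$ and the operator $S$ with kernel $h(s-u)-h(s)$. Both kernels are
square-integrable on $(-a,a)^2$, both factors are Hilbert–Schmidt, and a product of two such
operators is of trace class (`isTraceClass_comp_of_hasHilbertSchmidtBound`).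

The arithmetic input is only that $\Psi'$ is locally $L^2$ (`isL2Primitive_psiFormula`). On a
bounded interval the prime sum is a finite sum of ramps, and the only singularity of $\Psi'$ is that
of the Lerch term at $0$. It is logarithmic, and a bound by $s^{-1/4}$ suffices. Zeros of zeta play
no role. -/

/-! ### Hilbert–Schmidt bounds and trace class products -/

section TraceClass

variable {H : Type*} [NormedAddCommGroup H] [InnerProductSpace ℂ H]

/-- The squared Hilbert–Schmidt norm of `T` is at most `C`. -/
def HasHilbertSchmidtBound (T : H →L[ℂ] H) (C : ℝ) : Prop :=
  ∀ F : Finset H, Orthonormal ℂ (fun x : F => (x : H)) → ∑ x ∈ F, ‖T x‖ ^ 2 ≤ C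

theorem HasHilbertSchmidtBound.sum_le {T : H →L[ℂ] H} {C : ℝ} (hT : HasHilbertSchmidtBound T C)
    {s : Set H} {e : s → H} (he : Orthonormal ℂ e) (F : Finset s) :
    ∑ i ∈ F, ‖T (e i)‖ ^ 2 ≤ C := by
  classical
  have hinj : Function.Injective e := he.linearIndependent.injective
  have h := hT (F.image e) ?_
  · rwa [Finset.sum_image (fun x _ y _ hxy => hinj hxy)] at h
  · refine he.toSubtypeRange.comp (fun x : (F.image e : Finset H) => ⟨x, ?_⟩) ?_
    · obtain ⟨y, _, hy⟩ := Finset.mem_image.1 x.2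
      exact ⟨y, hy⟩
    · intro x y hxy
      exact Subtype.ext (congrArg (fun z : Set.range e => (z : H)) hxy)

theorem HasHilbertSchmidtBound.comp_left {T W : H →L[ℂ] H} {C : ℝ}
    (hT : HasHilbertSchmidtBound T C) (hW : ∀ x, ‖W x‖ ≤ ‖x‖) :
    HasHilbertSchmidtBound (W ∘L T) C := fun F hF =>
  (Finset.sum_le_sum fun x _ => pow_le_pow_left₀ (norm_nonneg _) (hW (T x)) 2).trans (hT F hF)

variable [CompleteSpace H]

/-- Expand each $\|T^*x\|^2$ by Parseval in a Hilbert basis $(b_i)$ and exchange sums; Bessel bounds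
$\sum_x|\langle Tb_i,x\rangle|^2$ by $\|Tb_i\|^2$. -/
theorem HasHilbertSchmidtBound.adjoint {T : H →L[ℂ] H} {C : ℝ}
    (hT : HasHilbertSchmidtBound T C) : HasHilbertSchmidtBound T.adjoint C := by
  intro F hF
  obtain ⟨w, b, -⟩ := exists_hilbertBasis ℂ H
  have hparseval : ∀ y : H, HasSum (fun i => ‖inner ℂ (b i) y‖ ^ 2) (‖y‖ ^ 2) := by
    intro y
    have h := Complex.reCLM.hasSum (b.hasSum_inner_mul_inner y y)
    have hy : Complex.reCLM (inner ℂ y y) = ‖y‖ ^ 2 := inner_self_eq_norm_sq (𝕜 := ℂ) y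
    rw [hy] at h
    refine h.congr_fun fun i => ?_
    rw [← inner_conj_symm y (b i), ← Complex.normSq_eq_conj_mul_self, Complex.normSq_eq_norm_sq]
    rfl
  have hsum : HasSum (fun i => ∑ x ∈ F, ‖inner ℂ (b i) (T.adjoint x)‖ ^ 2)
      (∑ x ∈ F, ‖T.adjoint x‖ ^ 2) := hasSum_sum fun x _ => hparseval _
  refine hasSum_le_of_sum_le hsum fun S => le_trans (Finset.sum_le_sum fun i _ => ?_)
    (hT.sum_le b.orthonormal S)
  have h := hF.sum_inner_products_le (T (b i)) (s := Finset.univ)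
  rw [← Finset.sum_coe_sort F]
  refine le_trans (le_of_eq (Finset.sum_congr rfl fun x _ => ?_)) h
  rw [ContinuousLinearMap.adjoint_inner_right, norm_inner_symm]

/-- An operator satisfying `‖P x‖ = ‖T x‖` factors through `T` by a contraction. -/
theorem exists_contraction_adjoint_comp_eq {T P : H →L[ℂ] H} (h : ∀ x, ‖P x‖ = ‖T x‖) :
    ∃ W : H →L[ℂ] H, (∀ x, ‖W x‖ ≤ ‖x‖) ∧ ∀ x, W (T x) = P x := by
  let M : Submodule ℂ H := (LinearMap.range (T : H →ₗ[ℂ] H)).topologicalClosure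
  have : CompleteSpace M :=
    (Submodule.isClosed_topologicalClosure _).completeSpace_coe
  have hM : ∀ x, (T : H →ₗ[ℂ] H) x ∈ M := fun x =>
    Submodule.le_topologicalClosure _ ⟨x, rfl⟩
  let e : H →ₗ[ℂ] M := (T : H →ₗ[ℂ] H).codRestrict M hM
  have hdense : DenseRange e := by
    intro y
    rw [closure_subtype]
    refine closure_mono ?_ y.2
    rintro _ ⟨x, rfl⟩
    exact ⟨e x, ⟨x, rfl⟩, rfl⟩
  have hnorm : ∀ x, ‖(P : H →ₗ[ℂ] H) x‖ ≤ 1 * ‖e x‖ := fun x => by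
    rw [one_mul]; exact (h x).le
  -- The map $Tx\mapsto Px$ is extended by continuity to the closure $M$ of the range of $T$, and by
  -- zero on $M^\perp$.
  refine ⟨(LinearMap.extendOfNorm (P : H →ₗ[ℂ] H) e) ∘L M.orthogonalProjectionOnto,
    fun x => ?_, fun x => ?_⟩
  · refine (LinearMap.norm_extendOfNorm_apply_le hdense 1 hnorm _).trans ?_
    rw [one_mul]
    exact M.norm_orthogonalProjectionOnto_apply_le x
  · have hx : M.orthogonalProjectionOnto (T x) = e x :=
      M.orthogonalProjectionOnto_mem_subspace_eq_self (e x)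
    rw [ContinuousLinearMap.comp_apply, hx]
    exact LinearMap.extendOfNorm_eq hdense ⟨1, hnorm⟩ x

theorem norm_abs_apply (T : H →L[ℂ] H) (x : H) : ‖CFC.abs T x‖ = ‖T x‖ := by
  have hsa : IsSelfAdjoint (CFC.abs T) := (CFC.abs_nonneg T).isSelfAdjoint
  have hmul : CFC.abs T * CFC.abs T = star T * T := CFC.abs_mul_abs T
  have h2 : inner ℂ (CFC.abs T x) (CFC.abs T x) = inner ℂ (T x) (T x) := by
    have h := congrArg (fun S : H →L[ℂ] H => inner ℂ (S x) x) hmul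
    simp only [mul_apply_eq_comp, ContinuousLinearMap.star_eq_adjoint,
      ContinuousLinearMap.adjoint_inner_left] at h
    rw [← h, ← ContinuousLinearMap.adjoint_inner_left, hsa.adjoint_eq]
  rw [inner_self_eq_norm_sq_to_K, inner_self_eq_norm_sq_to_K] at h2
  have h3 : ‖CFC.abs T x‖ ^ 2 = ‖T x‖ ^ 2 := by exact_mod_cast h2
  exact (sq_eq_sq₀ (norm_nonneg _) (norm_nonneg _)).1 h3

/-- Writing $|AB|=WAB$ with a contraction $W$ gives $\langle|AB|e,e\rangle=\langle
Be,(WA)^*e\rangle\le\frac12(\|(WA)^*e\|^2+\|Be\|^2)$, and both squares have bounded sums. -/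
theorem isTraceClass_comp_of_hasHilbertSchmidtBound {A B : H →L[ℂ] H} {C D : ℝ}
    (hA : HasHilbertSchmidtBound A C) (hB : HasHilbertSchmidtBound B D) :
    IsTraceClass (A ∘L B) := by
  intro s e
  obtain ⟨W, hW, hWT⟩ := exists_contraction_adjoint_comp_eq (norm_abs_apply (A ∘L B))
  have hWA := (hA.comp_left hW).adjoint
  have hpos : ∀ x, 0 ≤ (inner ℂ (CFC.abs (A ∘L B) x) x).re := fun x =>
    ((ContinuousLinearMap.nonneg_iff_isPositive _).1 (CFC.abs_nonneg (A ∘L B))).re_inner_nonneg_left x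
  refine summable_of_sum_le (c := (C + D) / 2) (fun i => hpos _) fun F => ?_
  have hterm : ∀ i : s, (inner ℂ (CFC.abs (A ∘L B) (e i)) (e i)).re ≤
      (‖(W ∘L A).adjoint (e i)‖ ^ 2 + ‖B (e i)‖ ^ 2) / 2 := by
    intro i
    have h1 : inner ℂ (CFC.abs (A ∘L B) (e i)) (e i) =
        inner ℂ (B (e i)) ((W ∘L A).adjoint (e i)) := by
      rw [ContinuousLinearMap.adjoint_inner_right, ← hWT]; rfl
    rw [h1]
    refine ((Complex.re_le_norm _).trans (norm_inner_le_norm _ _)).trans ?_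
    nlinarith [sq_nonneg (‖B (e i)‖ - ‖(W ∘L A).adjoint (e i)‖)]
  refine (Finset.sum_le_sum fun i _ => hterm i).trans ?_
  rw [← Finset.sum_div, Finset.sum_add_distrib]
  linarith [hWA.sum_le e.orthonormal F, hB.sum_le e.orthonormal F]

end TraceClass

/-! ### Integral operators with square-integrable kernels -/

section L2Kernel

variable {α : Type*} [MeasurableSpace α] {μ : Measure α}

theorem norm_sq_eq_integral_norm_sq (f : Lp ℂ 2 μ) : ‖f‖ ^ 2 = ∫ x, ‖f x‖ ^ 2 ∂μ := by
  rw [← inner_self_eq_norm_sq (𝕜 := ℂ), L2.inner_def]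
  have h : ∀ x, inner ℂ (f x) (f x) = ((‖f x‖ ^ 2 : ℝ) : ℂ) := fun x => by
    rw [inner_self_eq_norm_sq_to_K]; norm_cast
  simp_rw [h]
  rw [integral_complex_ofReal]
  exact Complex.ofReal_re _

theorem integrable_mul_coeFn {f : α → ℂ} (hf : MemLp f 2 μ) (φ : Lp ℂ 2 μ) :
    Integrable (fun u => f u * φ u) μ := hf.integrable_mul (Lp.memLp φ)

theorem integral_mul_eq_inner {f : α → ℂ} (hf : MemLp f 2 μ) (φ : Lp ℂ 2 μ) :
    ∫ u, f u * φ u ∂μ = inner ℂ (hf.star.toLp (star f)) φ := by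
  rw [L2.inner_def]
  refine integral_congr_ae ?_
  filter_upwards [hf.star.coeFn_toLp] with u hu
  rw [hu]
  simp [mul_comm]

theorem norm_toLp_star_sq {f : α → ℂ} (hf : MemLp f 2 μ) :
    ‖hf.star.toLp (star f)‖ ^ 2 = ∫ u, ‖f u‖ ^ 2 ∂μ := by
  rw [norm_sq_eq_integral_norm_sq]
  refine integral_congr_ae ?_
  filter_upwards [hf.star.coeFn_toLp] with u hu
  rw [hu]
  simp

theorem norm_sq_integral_mul_le {f : α → ℂ} (hf : MemLp f 2 μ) (φ : Lp ℂ 2 μ) :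
    ‖∫ u, f u * φ u ∂μ‖ ^ 2 ≤ (∫ u, ‖f u‖ ^ 2 ∂μ) * ‖φ‖ ^ 2 := by
  rw [integral_mul_eq_inner hf, ← norm_toLp_star_sq hf, ← mul_pow]
  exact pow_le_pow_left₀ (norm_nonneg _) (norm_inner_le_norm _ _) 2

variable [SFinite μ] {k : α → α → ℂ}

theorem ae_memLp_slice (hk : MemLp (Function.uncurry k) 2 (μ.prod μ)) :
    ∀ᵐ t ∂μ, MemLp (k t) 2 μ := by
  have h2 := (memLp_two_iff_integrable_sq_norm hk.1).1 hk
  filter_upwards [hk.1.prodMk_left, h2.prod_right_ae] with t ht1 ht2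
  exact (memLp_two_iff_integrable_sq_norm ht1).2 ht2

theorem integrable_integral_norm_sq_slice (hk : MemLp (Function.uncurry k) 2 (μ.prod μ)) :
    Integrable (fun t => ∫ u, ‖k t u‖ ^ 2 ∂μ) μ :=
  ((memLp_two_iff_integrable_sq_norm hk.1).1 hk).integral_prod_left

theorem memLp_integral_kernel_mul (hk : MemLp (Function.uncurry k) 2 (μ.prod μ))
    (φ : Lp ℂ 2 μ) : MemLp (fun t => ∫ u, k t u * φ u ∂μ) 2 μ := by
  have hm : AEStronglyMeasurable (fun t => ∫ u, k t u * φ u ∂μ) μ :=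
    (hk.1.mul (Lp.aestronglyMeasurable φ).comp_snd).integral_prod_right'
  rw [memLp_two_iff_integrable_sq_norm hm]
  refine ((integrable_integral_norm_sq_slice hk).mul_const (‖φ‖ ^ 2)).mono' (hm.norm.pow 2) ?_
  filter_upwards [ae_memLp_slice hk] with t ht
  rw [norm_pow, norm_norm]
  exact norm_sq_integral_mul_le ht φ

theorem norm_sq_toLp_integral_kernel_mul (hk : MemLp (Function.uncurry k) 2 (μ.prod μ))
    (φ : Lp ℂ 2 μ) : ‖(memLp_integral_kernel_mul hk φ).toLp _‖ ^ 2 =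
      ∫ t, ‖∫ u, k t u * φ u ∂μ‖ ^ 2 ∂μ := by
  rw [norm_sq_eq_integral_norm_sq]
  refine integral_congr_ae ?_
  filter_upwards [(memLp_integral_kernel_mul hk φ).coeFn_toLp] with u hu
  rw [hu]

/-- An integral operator with square-integrable kernel is bounded and Hilbert–Schmidt. -/
theorem exists_integral_operator (hk : MemLp (Function.uncurry k) 2 (μ.prod μ)) :
    ∃ T : Lp ℂ 2 μ →L[ℂ] Lp ℂ 2 μ,
      (∀ φ : Lp ℂ 2 μ, T φ =ᵐ[μ] fun t => ∫ u, k t u * φ u ∂μ) ∧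
      HasHilbertSchmidtBound T (∫ t, ∫ u, ‖k t u‖ ^ 2 ∂μ ∂μ) := by
  have hN := integrable_integral_norm_sq_slice hk
  have hsq : ∀ φ : Lp ℂ 2 μ, Integrable (fun t => ‖∫ u, k t u * φ u ∂μ‖ ^ 2) μ := fun φ =>
    (memLp_two_iff_integrable_sq_norm (memLp_integral_kernel_mul hk φ).1).1
      (memLp_integral_kernel_mul hk φ)
  have hC : 0 ≤ ∫ t, ∫ u, ‖k t u‖ ^ 2 ∂μ ∂μ := by positivity
  let L : Lp ℂ 2 μ →ₗ[ℂ] Lp ℂ 2 μ :=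
    { toFun := fun φ => (memLp_integral_kernel_mul hk φ).toLp _
      map_add' := fun φ ψ => by
        rw [← MemLp.toLp_add, MemLp.toLp_eq_toLp_iff]
        filter_upwards [ae_memLp_slice hk] with t ht
        rw [Pi.add_apply, ← integral_add (integrable_mul_coeFn ht φ) (integrable_mul_coeFn ht ψ)]
        refine integral_congr_ae ?_
        filter_upwards [Lp.coeFn_add φ ψ] with u hu
        rw [hu, Pi.add_apply, mul_add]
      map_smul' := fun c φ => by
        rw [RingHom.id_apply, ← MemLp.toLp_const_smul, MemLp.toLp_eq_toLp_iff]
        refine Filter.Eventually.of_forall fun t => ?_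
        rw [Pi.smul_apply, smul_eq_mul, ← integral_const_mul]
        refine integral_congr_ae ?_
        filter_upwards [Lp.coeFn_smul c φ] with u hu
        rw [hu, Pi.smul_apply, smul_eq_mul, mul_left_comm] }
  have hL : ∀ φ, ‖L φ‖ ^ 2 = ∫ t, ‖∫ u, k t u * φ u ∂μ‖ ^ 2 ∂μ :=
    norm_sq_toLp_integral_kernel_mul hk
  have hbound : ∀ φ, ‖L φ‖ ≤ √(∫ t, ∫ u, ‖k t u‖ ^ 2 ∂μ ∂μ) * ‖φ‖ := by
    intro φ
    refine (sq_le_sq₀ (norm_nonneg _) (by positivity)).1 ?_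
    rw [mul_pow, Real.sq_sqrt hC, hL, ← integral_mul_const]
    refine integral_mono_ae (hsq φ) (hN.mul_const _) ?_
    filter_upwards [ae_memLp_slice hk] with t ht
    exact norm_sq_integral_mul_le ht φ
  refine ⟨L.mkContinuous _ hbound, fun φ => (memLp_integral_kernel_mul hk φ).coeFn_toLp, ?_⟩
  intro F hF
  simp_rw [LinearMap.mkContinuous_apply, hL]
  rw [← integral_finsetSum _ fun φ _ => hsq φ]
  refine integral_mono_ae (integrable_finsetSum _ fun φ _ => hsq φ) hN ?_
  filter_upwards [ae_memLp_slice hk] with t ht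
  -- Bessel's inequality for the conjugate slice of the kernel at fixed $t$; integration over $t$
  -- gives the bound.
  have h := hF.sum_inner_products_le (ht.star.toLp (star (k t))) (s := Finset.univ)
  rw [norm_toLp_star_sq ht] at h
  refine le_trans (le_of_eq ?_) h
  rw [← Finset.sum_coe_sort F]
  refine Finset.sum_congr rfl fun φ _ => ?_
  rw [integral_mul_eq_inner ht, norm_inner_symm]

end L2Kernel

noncomputable section

/-! ### Factorization of the screw kernel -/

section ScrewKernel

/-- The kernel of integration from `0` to `t`. -/
def volterraKernel (t s : ℝ) : ℂ :=
  if 0 < s ∧ s < t then 1 else if t < s ∧ s < 0 then -1 else 0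

theorem measurable_volterraKernel : Measurable (Function.uncurry volterraKernel) := by
  refine Measurable.ite ?_ measurable_const (Measurable.ite ?_ measurable_const measurable_const)
  · exact (measurableSet_lt measurable_const measurable_snd).inter
      (measurableSet_lt measurable_snd measurable_fst)
  · exact (measurableSet_lt measurable_fst measurable_snd).inter
      (measurableSet_lt measurable_snd measurable_const)

theorem norm_volterraKernel_le (t s : ℝ) : ‖volterraKernel t s‖ ≤ 1 := by
  unfold volterraKernel; split_ifs <;> simp

theorem integral_volterraKernel_mul {a t : ℝ} (ht : t ∈ Set.Icc (-a) a) (f : ℝ → ℂ) :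
    ∫ s in Set.Ioo (-a) a, volterraKernel t s * f s = ∫ s in (0 : ℝ)..t, f s := by
  rcases le_total 0 t with h0 | h0
  · have h : ∀ s, volterraKernel t s * f s = (Set.Ioo 0 t).indicator f s := by
      intro s
      unfold volterraKernel
      by_cases hs : 0 < s ∧ s < t
      · rw [if_pos hs, Set.indicator_of_mem (by exact hs), one_mul]
      · rw [if_neg hs, if_neg (by rintro ⟨h1, h2⟩; linarith), Set.indicator_of_notMem (by exact hs),
          zero_mul]
    simp_rw [h]
    rw [setIntegral_indicator measurableSet_Ioo, intervalIntegral.integral_of_le h0,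
      integral_Ioc_eq_integral_Ioo, Set.inter_eq_right.2]
    exact Set.Ioo_subset_Ioo (by linarith [ht.1, ht.2]) ht.2
  · have h : ∀ s, volterraKernel t s * f s = (Set.Ioo t 0).indicator (fun x => -f x) s := by
      intro s
      unfold volterraKernel
      by_cases hs : t < s ∧ s < 0
      · rw [if_pos hs, if_neg (by rintro ⟨h1, h2⟩; linarith [hs.2]),
          Set.indicator_of_mem (by exact hs), neg_one_mul]
      · rw [if_neg hs, if_neg (by rintro ⟨h1, h2⟩; linarith), Set.indicator_of_notMem (by exact hs),
          zero_mul]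
    simp_rw [h]
    rw [setIntegral_indicator measurableSet_Ioo, intervalIntegral.integral_of_ge h0,
      integral_Ioc_eq_integral_Ioo, Set.inter_eq_right.2, integral_neg]
    exact Set.Ioo_subset_Ioo ht.1 (by linarith [ht.1, ht.2])

theorem memLp_volterraKernel (μ : Measure ℝ) [IsFiniteMeasure μ] :
    MemLp (Function.uncurry volterraKernel) 2 (μ.prod μ) :=
  MemLp.of_bound measurable_volterraKernel.aestronglyMeasurable 1
    (Filter.Eventually.of_forall fun p => norm_volterraKernel_le p.1 p.2)

theorem memLp_sub_kernel {h : ℝ → ℝ} (hm : Measurable h) (h2 : MemLp h 2 volume) (a : ℝ) :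
    MemLp (Function.uncurry fun s u => ((h (s - u) - h s : ℝ) : ℂ)) 2
      ((volume.restrict (Set.Ioo (-a) a)).prod (volume.restrict (Set.Ioo (-a) a))) := by
  set μ := volume.restrict (Set.Ioo (-a) a) with hμ
  have hsq : Integrable (fun x => h x ^ 2) volume :=
    (memLp_two_iff_integrable_sq hm.aestronglyMeasurable).1 h2
  have hdiff : MemLp (fun p : ℝ × ℝ => h (p.1 - p.2)) 2 (μ.prod μ) := by
    have hmeas : Measurable fun p : ℝ × ℝ => h (p.1 - p.2) :=
      hm.comp (measurable_fst.sub measurable_snd)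
    rw [memLp_two_iff_integrable_sq hmeas.aestronglyMeasurable]
    -- $h(s-u)^2$ is the integrand of the convolution of $1\in L^1(\mu)$ with $h^2\in L^1(\mathbb
    -- R)$.
    have hc := Integrable.convolution_integrand (ContinuousLinearMap.mul ℝ ℝ)
      (integrable_const (1 : ℝ) : Integrable (fun _ : ℝ => (1 : ℝ)) μ) hsq
    have hr : μ.prod μ = (volume.prod μ).restrict (Set.Ioo (-a) a ×ˢ Set.univ) := by
      rw [← Measure.prod_restrict, Measure.restrict_univ]
    rw [hr]
    refine (hc.congr (Filter.Eventually.of_forall fun p => ?_)).integrableOn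
    simp
  exact (hdiff.sub ((h2.restrict _).comp_fst μ)).ofReal

/-- The screw kernel of a primitive of a square-integrable function defines a trace class operator. -/
theorem exists_isIntegralOperator_screwKernel_isTraceClass {a : ℝ} {g h : ℝ → ℝ}
    (hm : Measurable h) (h2 : MemLp h 2 volume)
    (hg : ∀ t ∈ Set.Icc (-(2 * a)) (2 * a), g t - g 0 = ∫ s in (0 : ℝ)..t, h s) :
    ∃ T : L2Interval a →L[ℂ] L2Interval a,
      IsIntegralOperator a (screwKernel g) T ∧ IsTraceClass T := by
  set μ := volume.restrict (Set.Ioo (-a) a) with hμ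
  have hk := memLp_sub_kernel hm h2 a
  obtain ⟨V, hV, hVHS⟩ := exists_integral_operator (memLp_volterraKernel μ)
  obtain ⟨S, hS, hSHS⟩ := exists_integral_operator hk
  refine ⟨V ∘L S, fun φ => ?_, isTraceClass_comp_of_hasHilbertSchmidtBound hVHS hSHS⟩
  have hint : ∀ x y, IntervalIntegrable h volume x y := fun x y => by
    have : IsFiniteMeasure (volume.restrict (Set.uIoc x y)) :=
      ⟨by rw [Measure.restrict_apply_univ, Set.uIoc]; exact measure_Ioc_lt_top⟩
    exact intervalIntegrable_iff.2 ((h2.restrict _).integrable one_le_two)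
  -- The kernel of $VS$ is the screw kernel. Since $t-u$ fills up $(-2a,2a)$, the primitive is
  -- needed on the doubled interval.
  have hkernel : ∀ t ∈ Set.Icc (-a) a, ∀ u ∈ Set.Ioo (-a) a,
      ∫ s, volterraKernel t s * ((h (s - u) - h s : ℝ) : ℂ) ∂μ = (screwKernel g t u : ℂ) := by
    intro t ht u hu
    have hshift : IntervalIntegrable (fun s => h (s - u)) volume 0 t := by
      simpa using (hint (0 - u) (t - u)).comp_sub_right u
    rw [hμ, integral_volterraKernel_mul ht, intervalIntegral.integral_ofReal,
      intervalIntegral.integral_sub hshift (hint _ _),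
      intervalIntegral.integral_comp_sub_right, zero_sub,
      ← intervalIntegral.integral_interval_sub_left (hint 0 _) (hint 0 _),
      ← hg t ⟨by linarith [ht.1, ht.2], by linarith [ht.1, ht.2]⟩,
      ← hg (t - u) ⟨by linarith [ht.1, hu.2], by linarith [ht.2, hu.1]⟩,
      ← hg (-u) ⟨by linarith [hu.1, hu.2], by linarith [hu.1, hu.2]⟩]
    congr 1
    unfold screwKernel
    ring
  -- Joint integrability for every $t$, not just almost every $t$: it gives absolute convergence at
  -- each point and justifies Fubini.
  have hprod : ∀ t, Integrable (fun p : ℝ × ℝ =>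
      volterraKernel t p.1 * (((h (p.1 - p.2) - h p.1 : ℝ) : ℂ) * φ p.2)) (μ.prod μ) := by
    intro t
    refine Integrable.bdd_mul (c := 1) (hk.integrable_mul ((Lp.memLp φ).comp_snd μ)) ?_
      (Filter.Eventually.of_forall fun p => norm_volterraKernel_le t p.1)
    exact (measurable_volterraKernel.comp
      (measurable_const.prodMk measurable_fst)).aestronglyMeasurable
  have hmul : ∀ t ∈ Set.Icc (-a) a, (fun u => ∫ s, volterraKernel t s *
      (((h (s - u) - h s : ℝ) : ℂ) * φ u) ∂μ) =ᵐ[μ] fun u => (screwKernel g t u : ℂ) * φ u := by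
    intro t ht
    filter_upwards [ae_restrict_mem measurableSet_Ioo] with u hu
    simp_rw [← mul_assoc]
    rw [integral_mul_const, hkernel t ht u hu]
  refine ⟨fun t ht => (hprod t).integral_prod_right.congr (hmul t ht), ?_⟩
  filter_upwards [hV (S φ), ae_restrict_mem measurableSet_Ioo] with t ht hta
  rw [ContinuousLinearMap.comp_apply, ht, ← integral_congr_ae (hmul t (Set.Ioo_subset_Icc_self hta)),
    ← integral_integral_swap (hprod t)]
  refine integral_congr_ae ?_
  filter_upwards [hS φ] with s hs
  rw [hs, ← integral_const_mul]

end ScrewKernel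

end

noncomputable section

/-! ### Primitives of square-integrable functions -/

section Primitive

/-- On `[0, b]`, the function `f` is a primitive of a square-integrable function. -/
def IsL2Primitive (b : ℝ) (f : ℝ → ℝ) : Prop :=
  ∃ h : ℝ → ℝ, Measurable h ∧ MemLp h 2 (volume.restrict (Set.Ioc 0 b)) ∧
    ∀ t ∈ Set.Icc 0 b, f t - f 0 = ∫ s in (0 : ℝ)..t, h s

theorem intervalIntegrable_of_memLp_two {b t : ℝ} {h : ℝ → ℝ}
    (h2 : MemLp h 2 (volume.restrict (Set.Ioc 0 b))) (ht : t ∈ Set.Icc 0 b) :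
    IntervalIntegrable h volume 0 t := by
  have hb : IntegrableOn h (Set.Ioc 0 b) volume := h2.integrable one_le_two
  rw [intervalIntegrable_iff_integrableOn_Ioc_of_le ht.1]
  exact hb.mono_set (Set.Ioc_subset_Ioc_right ht.2)

variable {b : ℝ} {f f₁ f₂ : ℝ → ℝ}

theorem IsL2Primitive.congr (hf : IsL2Primitive b f₁) (h : Set.EqOn f₂ f₁ (Set.Icc 0 b)) :
    IsL2Primitive b f₂ := by
  obtain ⟨k, hk, hk2, hkf⟩ := hf
  refine ⟨k, hk, hk2, fun t ht => ?_⟩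
  rw [h ht, h ⟨le_rfl, ht.1.trans ht.2⟩, hkf t ht]

theorem IsL2Primitive.add (h₁ : IsL2Primitive b f₁) (h₂ : IsL2Primitive b f₂) :
    IsL2Primitive b fun t => f₁ t + f₂ t := by
  obtain ⟨k₁, hm₁, hL₁, hf₁⟩ := h₁
  obtain ⟨k₂, hm₂, hL₂, hf₂⟩ := h₂
  refine ⟨fun s => k₁ s + k₂ s, hm₁.add hm₂, hL₁.add hL₂, fun t ht => ?_⟩
  rw [intervalIntegral.integral_add (intervalIntegrable_of_memLp_two hL₁ ht)
    (intervalIntegrable_of_memLp_two hL₂ ht), ← hf₁ t ht, ← hf₂ t ht]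
  ring

theorem IsL2Primitive.const_mul (c : ℝ) (hf : IsL2Primitive b f) :
    IsL2Primitive b fun t => c * f t := by
  obtain ⟨k, hm, hL, hk⟩ := hf
  refine ⟨fun s => c * k s, hm.const_mul c, hL.const_mul c, fun t ht => ?_⟩
  rw [intervalIntegral.integral_const_mul, ← hk t ht]
  ring

theorem isL2Primitive_const (c : ℝ) : IsL2Primitive b fun _ => c :=
  ⟨fun _ => 0, measurable_const, MemLp.zero, fun t _ => by simp⟩

theorem IsL2Primitive.sum {ι : Type*} {F : ι → ℝ → ℝ} (s : Finset ι)
    (h : ∀ i ∈ s, IsL2Primitive b (F i)) : IsL2Primitive b fun t => ∑ i ∈ s, F i t := by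
  classical
  induction s using Finset.induction_on with
  | empty => simpa using isL2Primitive_const 0
  | insert i s his ih =>
    simp_rw [Finset.sum_insert his]
    exact (h i (Finset.mem_insert_self i s)).add
      (ih fun j hj => h j (Finset.mem_insert_of_mem hj))

theorem isL2Primitive_of_hasDerivAt {f' : ℝ → ℝ} (hf : ∀ x, HasDerivAt f (f' x) x)
    (hc : Continuous f') : IsL2Primitive b f := by
  refine ⟨f', hc.measurable, ?_, fun t _ => ?_⟩
  · obtain ⟨M, hM⟩ := (isCompact_Icc (a := (0 : ℝ)) (b := b)).exists_bound_of_continuousOn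
      hc.continuousOn
    refine MemLp.of_bound hc.aestronglyMeasurable M ?_
    filter_upwards [ae_restrict_mem measurableSet_Ioc] with x hx
    exact hM x (Set.Ioc_subset_Icc_self hx)
  · exact (intervalIntegral.integral_eq_sub_of_hasDerivAt (fun x _ => hf x)
      (hc.intervalIntegrable _ _)).symm

theorem isL2Primitive_max_sub {c : ℝ} (hc : 0 ≤ c) :
    IsL2Primitive b fun t => max (t - c) 0 := by
  refine ⟨(Set.Ioi c).indicator fun _ => 1, measurable_const.indicator measurableSet_Ioi, ?_,
    fun t ht => ?_⟩
  · exact (memLp_const 1).indicator measurableSet_Ioi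
  · rw [intervalIntegral.integral_of_le ht.1, setIntegral_indicator measurableSet_Ioi,
      Set.Ioc_inter_Ioi, max_eq_right hc, setIntegral_const, smul_eq_mul, mul_one,
      Real.volume_real_Ioc]
    simp [hc]

theorem exists_memLp_primitive_of_abs {F : ℝ → ℝ} (hF : IsL2Primitive b F) :
    ∃ h : ℝ → ℝ, Measurable h ∧ MemLp h 2 volume ∧
      ∀ t ∈ Set.Icc (-b) b, F |t| - F |0| = ∫ s in (0 : ℝ)..t, h s := by
  obtain ⟨k, hm, hL, hk⟩ := hF
  set k₀ := (Set.Ioc 0 b).indicator k with hk₀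
  have hm₀ : Measurable k₀ := hm.indicator measurableSet_Ioc
  have hL₀ : MemLp k₀ 2 volume := (memLp_indicator_iff_restrict measurableSet_Ioc).2 hL
  have hpos : ∀ t ∈ Set.Icc 0 b, ∫ s in (0 : ℝ)..t, (k₀ s - k₀ (-s)) = F t - F 0 := by
    intro t ht
    rw [hk t ht, intervalIntegral.integral_of_le ht.1, intervalIntegral.integral_of_le ht.1]
    refine setIntegral_congr_fun measurableSet_Ioc fun s hs => ?_
    have h1 : s ∈ Set.Ioc 0 b := ⟨hs.1, hs.2.trans ht.2⟩
    have h2 : -s ∉ Set.Ioc 0 b := fun h => by linarith [h.1, hs.1]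
    simp only [hk₀, Set.indicator_of_mem h1, Set.indicator_of_notMem h2, sub_zero]
  -- The derivative of an even extension is the odd extension of the derivative.
  refine ⟨fun s => k₀ s - k₀ (-s), hm₀.sub (hm₀.comp measurable_neg),
    hL₀.sub (hL₀.comp_measurePreserving (Measure.measurePreserving_neg volume)), fun t ht => ?_⟩
  rw [abs_zero]
  rcases le_total 0 t with h0 | h0
  · rw [abs_of_nonneg h0, hpos t ⟨h0, ht.2⟩]
  · rw [abs_of_nonpos h0, ← hpos (-t) ⟨by linarith, by linarith [ht.1]⟩]
    have h := intervalIntegral.integral_comp_neg (a := 0) (b := -t)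
      (fun s => k₀ (-s) - k₀ s)
    simp only [neg_neg, neg_zero] at h
    rw [h, intervalIntegral.integral_symm, ← intervalIntegral.integral_neg]
    simp only [neg_sub]

end Primitive

/-! ### Square-integrability of the derivative of $\Psi$ -/

section ZetaScrew

theorem exp_neg_two_mul_le_rpow {x : ℝ} (hx : 0 < x) :
    Real.exp (-(2 * x)) ≤ x ^ (-(1 / 4) : ℝ) := by
  rw [Real.rpow_neg hx.le, Real.exp_neg]
  refine inv_anti₀ (Real.rpow_pos_of_pos hx _) ?_
  calc x ^ (1 / 4 : ℝ) ≤ Real.exp x ^ (1 / 4 : ℝ) :=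
        Real.rpow_le_rpow hx.le (by linarith [Real.add_one_le_exp x]) (by norm_num)
    _ = Real.exp (x * (1 / 4)) := (Real.exp_mul _ _).symm
    _ ≤ Real.exp (2 * x) := Real.exp_le_exp.2 (by linarith)

theorem summable_add_quarter_rpow {r : ℝ} (hr : 1 < r) :
    Summable fun n : ℕ => ((n : ℝ) + 1 / 4) ^ (-r) := by
  refine ((Real.summable_one_div_nat_add_rpow (1 / 4) r).2 hr).congr fun n => ?_
  rw [abs_of_pos (by positivity), Real.rpow_neg (by positivity), one_div]

theorem exp_mul_hurwitzLerchPhi (t : ℝ) :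
    Real.exp (-t / 2) * hurwitzLerchPhi (Real.exp (-2 * t)) 2 (1 / 4) =
      ∑' n : ℕ, ((n : ℝ) + 1 / 4) ^ (-2 : ℝ) * Real.exp (-(2 * ((n : ℝ) + 1 / 4) * t)) := by
  unfold hurwitzLerchPhi
  rw [← tsum_mul_left]
  refine tsum_congr fun n => ?_
  rw [← Real.exp_nat_mul, mul_left_comm, ← Real.exp_add]
  ring_nf

theorem integral_exp_neg_mul {c t : ℝ} (hc : 0 < c) :
    ∫ s in (0 : ℝ)..t, 2 * c⁻¹ * Real.exp (-(2 * c * s)) =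
      c ^ (-2 : ℝ) * (1 - Real.exp (-(2 * c * t))) := by
  have hd : ∀ x, HasDerivAt (fun s => -(c ^ (-2 : ℝ)) * Real.exp (-(2 * c * s)))
      (2 * c⁻¹ * Real.exp (-(2 * c * x))) x := by
    intro x
    have h := ((((hasDerivAt_id x).const_mul (2 * c)).neg).exp).const_mul (-(c ^ (-2 : ℝ)))
    refine h.congr_deriv ?_
    rw [Real.rpow_neg hc.le, Real.rpow_two]
    simp only [Pi.neg_apply, id]
    field_simp
  rw [intervalIntegral.integral_eq_sub_of_hasDerivAt (fun x _ => hd x)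
    (Continuous.intervalIntegrable (by fun_prop) _ _)]
  simp only [mul_zero, neg_zero, Real.exp_zero]
  ring

/-- Separates $c$ from $s$. Any exponent $\theta\in(0,1/2)$ in place of $1/4$ would do: $\sum_n
(n+1/4)^{-1-\theta}$ converges and $s^{-2\theta}$ is integrable at $0$. -/
theorem inv_mul_exp_le {c s : ℝ} (hc : 0 < c) (hs : 0 < s) :
    2 * c⁻¹ * Real.exp (-(2 * c * s)) ≤ 2 * s ^ (-(1 / 4) : ℝ) * c ^ (-(5 / 4) : ℝ) := by
  have h := exp_neg_two_mul_le_rpow (mul_pos hc hs)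
  rw [Real.mul_rpow hc.le hs.le] at h
  have h5 : c ^ (-(5 / 4) : ℝ) = c⁻¹ * c ^ (-(1 / 4) : ℝ) := by
    rw [← Real.rpow_neg_one, ← Real.rpow_add hc]; norm_num
  rw [h5, mul_assoc 2 c s]
  have := mul_le_mul_of_nonneg_left h (by positivity : 0 ≤ 2 * c⁻¹)
  linarith

theorem isL2Primitive_exp_mul_hurwitzLerchPhi {b : ℝ} (hb : 0 ≤ b) : IsL2Primitive b fun t =>
    Real.exp (-t / 2) * hurwitzLerchPhi (Real.exp (-2 * t)) 2 (1 / 4) := by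
  simp_rw [exp_mul_hurwitzLerchPhi]
  set c : ℕ → ℝ := fun n => (n : ℝ) + 1 / 4 with hcdef
  have hc : ∀ n, 0 < c n := fun n => by positivity
  have hc2 : Summable fun n => c n ^ (-2 : ℝ) := summable_add_quarter_rpow (by norm_num)
  have hc5 : Summable fun n => c n ^ (-(5 / 4) : ℝ) := summable_add_quarter_rpow (by norm_num)
  set F : ℕ → ℝ → ℝ := fun n s => 2 * (c n)⁻¹ * Real.exp (-(2 * c n * s)) with hF
  have hF0 : ∀ n s, 0 ≤ F n s := fun n s => by have := hc n; positivity
  have hFm : ∀ n, Continuous (F n) := fun n => by fun_prop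
  have hmeas : Measurable fun s => ∑' n, F n s := by
    have heq : (fun s => ∑' n, F n s) = fun s => (∑' n, ENNReal.ofReal (F n s)).toReal := by
      funext s
      rw [ENNReal.tsum_toReal_eq fun n => ENNReal.ofReal_ne_top]
      exact tsum_congr fun n => (ENNReal.toReal_ofReal (hF0 n s)).symm
    rw [heq]
    exact (Measurable.tsum fun n => (hFm n).measurable.ennreal_ofReal).ennreal_toReal
  -- The sign is flipped because the negated series is increasing, so its termwise derivatives `F n`
  -- are nonnegative.
  suffices h : IsL2Primitive b fun t => -1 * -∑' n, c n ^ (-2 : ℝ) * Real.exp (-(2 * c n * t)) by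
    simpa only [neg_mul, one_mul, neg_neg] using h
  refine IsL2Primitive.const_mul _ ⟨fun s => ∑' n, F n s, hmeas, ?_, fun t ht => ?_⟩
  · have hbd : ∀ s ∈ Set.Ioc 0 b, ‖∑' n, F n s‖ ≤
        ‖(2 * ∑' n, c n ^ (-(5 / 4) : ℝ)) * s ^ (-(1 / 4) : ℝ)‖ := by
      intro s hs
      have hs5 := hc5.mul_left (2 * s ^ (-(1 / 4) : ℝ))
      have hle : ∀ n, F n s ≤ 2 * s ^ (-(1 / 4) : ℝ) * c n ^ (-(5 / 4) : ℝ) := fun n =>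
        inv_mul_exp_le (hc n) hs.1
      rw [Real.norm_of_nonneg (tsum_nonneg fun n => hF0 n s)]
      refine (Summable.tsum_le_tsum hle (hs5.of_nonneg_of_le (fun n => hF0 n s) hle) hs5).trans
        (le_trans (le_of_eq ?_) (le_abs_self _))
      rw [tsum_mul_left]
      ring
    have hrpow : MemLp (fun s : ℝ => s ^ (-(1 / 4) : ℝ)) 2 (volume.restrict (Set.Ioc 0 b)) := by
      rw [memLp_two_iff_integrable_sq (by fun_prop)]
      have h : IntegrableOn (fun s : ℝ => s ^ (-(1 / 2) : ℝ)) (Set.Ioc 0 b) volume :=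
        (intervalIntegrable_iff_integrableOn_Ioc_of_le hb).1
          (intervalIntegral.intervalIntegrable_rpow' (by norm_num))
      refine h.congr_fun (fun s hs => ?_) measurableSet_Ioc
      simp only
      rw [← Real.rpow_natCast, ← Real.rpow_mul hs.1.le]
      norm_num
    refine (hrpow.const_mul (2 * ∑' n, c n ^ (-(5 / 4) : ℝ))).mono hmeas.aestronglyMeasurable ?_
    filter_upwards [ae_restrict_mem measurableSet_Ioc] with s hs
    exact hbd s hs
  · have hint : ∀ n, Integrable (F n) (volume.restrict (Set.Ioc 0 t)) := fun n =>
      ((hFm n).integrableOn_Icc).mono_set Set.Ioc_subset_Icc_self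
    have hval : ∀ n, ∫ s in Set.Ioc 0 t, F n s =
        c n ^ (-2 : ℝ) * (1 - Real.exp (-(2 * c n * t))) := fun n => by
      rw [← intervalIntegral.integral_of_le ht.1, integral_exp_neg_mul (hc n)]
    have hE : ∀ n, Real.exp (-(2 * c n * t)) ≤ 1 := fun n =>
      Real.exp_le_one_iff.2 (by have := hc n; have := ht.1; rw [neg_nonpos]; positivity)
    have hsumE : Summable fun n => c n ^ (-2 : ℝ) * Real.exp (-(2 * c n * t)) :=
      hc2.of_nonneg_of_le (fun n => by have := hc n; positivity)
        (fun n => mul_le_of_le_one_right (by have := hc n; positivity) (hE n))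
    -- By positivity the $L^1$ norms are the integrals themselves, so termwise integration is
    -- allowed despite the singularity at $0$.
    have hsum : Summable fun n => ∫ s in Set.Ioc 0 t, ‖F n s‖ := by
      refine (hc2.sub hsumE).congr fun n => ?_
      simp_rw [fun s => Real.norm_of_nonneg (hF0 n s)]
      rw [hval]; ring
    rw [intervalIntegral.integral_of_le ht.1, ← integral_tsum_of_summable_integral_norm hint hsum]
    simp_rw [hval, mul_sub, mul_one]
    rw [hc2.tsum_sub hsumE]
    simp
    ring

/-- Each summand vanishes at $t=\log n$, where it enters, so it is a ramp; for $t\le b$ the range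
can be frozen at $n\le e^b$. -/
theorem isL2Primitive_sum_vonMangoldt (b : ℝ) : IsL2Primitive b fun t =>
    ∑ n ∈ Finset.Icc 1 ⌊Real.exp t⌋₊,
      ArithmeticFunction.vonMangoldt n / √(n : ℝ) * (t - Real.log n) := by
  refine (IsL2Primitive.sum (Finset.Icc 1 ⌊Real.exp b⌋₊) fun n _ =>
    (isL2Primitive_max_sub (Real.log_natCast_nonneg n)).const_mul
      (ArithmeticFunction.vonMangoldt n / √(n : ℝ))).congr fun t ht => ?_
  have hiff : ∀ n : ℕ, 1 ≤ n → (n ≤ ⌊Real.exp t⌋₊ ↔ Real.log n ≤ t) := fun n hn => by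
    rw [Nat.le_floor_iff (Real.exp_pos t).le, Real.log_le_iff_le_exp (by exact_mod_cast hn)]
  have hsub : Finset.Icc 1 ⌊Real.exp t⌋₊ ⊆ Finset.Icc 1 ⌊Real.exp b⌋₊ :=
    Finset.Icc_subset_Icc_right (Nat.floor_mono (Real.exp_le_exp.2 ht.2))
  refine Eq.trans (Finset.sum_congr rfl fun n hn => ?_) (Finset.sum_subset hsub fun n hn hn' => ?_)
  · rw [Finset.mem_Icc] at hn
    rw [max_eq_left (sub_nonneg.2 ((hiff n hn.1).1 hn.2))]
  · rw [Finset.mem_Icc] at hn hn'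
    rw [max_eq_right, mul_zero]
    by_contra h
    exact hn' ⟨hn.1, (hiff n hn.1).2 (by linarith)⟩

theorem isL2Primitive_psiFormula {b : ℝ} (hb : 0 ≤ b) : IsL2Primitive b psiFormula := by
  have hexp : IsL2Primitive b fun t : ℝ => 4 * (Real.exp (t / 2) + Real.exp (-t / 2) - 2) := by
    refine isL2Primitive_of_hasDerivAt
      (f' := fun t => 4 * (Real.exp (t / 2) * (1 / 2) + Real.exp (-t / 2) * (-1 / 2)))
      (fun x => ?_) (by fun_prop)
    exact (((((hasDerivAt_id x).div_const 2).exp).add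
      (((hasDerivAt_id x).neg.div_const 2).exp)).sub_const 2).const_mul 4
  have hlin : ∀ B : ℝ, IsL2Primitive b fun t : ℝ => t / 2 * B := fun B =>
    isL2Primitive_of_hasDerivAt (f' := fun _ => 1 / 2 * B)
      (fun x => ((hasDerivAt_id x).div_const 2).mul_const B) continuous_const
  refine (((hexp.add ((isL2Primitive_sum_vonMangoldt b).const_mul (-1))).add
    (hlin (deriv Real.Gamma (1 / 4) / Real.Gamma (1 / 4) - Real.log Real.pi))).add
    (((isL2Primitive_const (Real.pi ^ 2 + 8 * catalanConstant)).add
      ((isL2Primitive_exp_mul_hurwitzLerchPhi hb).const_mul (-1))).const_mul (1 / 4))).congr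
    fun t _ => ?_
  unfold psiFormula
  ring

end ZetaScrew

end

theorem theorem1p5 (a : ℝ) (ha : 0 < a) :
    ∃ T : L2Interval a →L[ℂ] L2Interval a,
      IsIntegralOperator a (screwKernel zetaScrew) T ∧ IsTraceClass T := by
  obtain ⟨h, hm, h2, hh⟩ := exists_memLp_primitive_of_abs
    ((isL2Primitive_psiFormula (b := 2 * a) (by linarith)).const_mul (-1))
  refine exists_isIntegralOperator_screwKernel_isTraceClass hm h2 fun t ht => ?_
  rw [← hh t ht]
  unfold zetaScrew zetaPsi
  ring
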